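/- Let $G$ be a (Hausdorff) locally compact group that is totally disconnected, non-discrete, generated by a compact subset, and topologically simple (that is, $G\neq\{e\}$ and the only closed normal subgroups of $G$ are $\{e\}$ and $G$). A subgroup of $G$ is called locally normal if it is compact and its normaliser in $G$ is open. Let $\mathcal{LN}(G)$ be the set of commensurability classes $[K]$ of locally normal subgroups $K$ of $G$, with the partial order induced by inclusion of representatives, so that the meet is given by $[K]\wedge[L]=[K\cap L]$; let $0=[\{e\}]$, let $\infty$ be the class of the compact open subgroups, and let $G$ act on $\mathcal{LN}(G)$ by conjugation of representatives. For every $\alpha\in\mathcal{LN}(G)$ there are a compact open subgroup $U$ of $G$ and a representative $K$ of $\alpha$ that is a closed normal subgroup of $U$, and the class $\alpha^\perp:=[C_U(K)]$ depends only on $\alpha$, not on the choice of $U$ and $K$. Put $$\mathcal{LC}(G)=\{\alpha^\perp \mid \alpha\in\mathcal{LN}(G)\},\qquad \alpha\vee'\beta=(\alpha^\perp\wedge\beta^\perp)^\perp .$$ Theorem. The set $\mathcal{LC}(G)$ is closed under $\vee'$, $\wedge$ and $\perp$, and with $\vee'$ as join, $\wedge$ as meet and $\perp$ as complement it is a Boolean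 lattice; its order is the one induced from $\mathcal{LN}(G)$, its least element is $0$ and its greatest element is $\infty$. The action of $G$ on $\mathcal{LN}(G)$ preserves $\mathcal{LC}(G)$, and $G$ acts on $\mathcal{LC}(G)$ by automorphisms of this Boolean lattice. -/

import Mathlib

open scoped Pointwise

namespace TDLC

/-- The class `𝒮`: compactly generated locally compact groups that are totally disconnected,
topologically simple and non-discrete.  (Compact generation is in the group-theoretic sense:
the group is generated by a compact subset.) -/
structure MemS (G : Type*) [Group G] [TopologicalSpace G] [IsTopologicalGroup G] : Prop where
  locallyCompact : LocallyCompactSpace G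
  totallyDisconnected : TotallyDisconnectedSpace G
  compactlyGenerated : ∃ S : Set G, IsCompact S ∧ Subgroup.closure S = ⊤
  nontrivial : Nontrivial G
  topologicallySimple :
    ∀ N : Subgroup G, N.Normal → IsClosed (N : Set G) → N = ⊥ ∨ N = ⊤
  nonDiscrete : ¬ DiscreteTopology G

section Basic

variable (G : Type*) [Group G] [TopologicalSpace G]

/-- A locally normal subgroup: a compact subgroup whose normaliser is open. -/
structure LocallyNormal where
  toSubgroup : Subgroup G
  isCompact : IsCompact (toSubgroup : Set G)
  isOpen_normalizer : IsOpen (Subgroup.normalizer (toSubgroup : Set G) : Set G)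

/-- Commensurability of locally normal subgroups. -/
instance LocallyNormal.setoid : Setoid (LocallyNormal G) where
  r K L := Subgroup.Commensurable K.toSubgroup L.toSubgroup
  iseqv := ⟨fun K => Subgroup.Commensurable.refl K.toSubgroup, fun h => h.symm,
    fun h₁ h₂ => h₁.trans h₂⟩

/-- The set of commensurability classes of locally normal subgroups: the structure lattice. -/
def LN : Type _ := Quotient (LocallyNormal.setoid G)

end Basic

section Order

variable {G : Type*} [Group G] [TopologicalSpace G]

/-- The commensurability class of a locally normal subgroup. -/
def LN.mk (K : LocallyNormal G) : LN G := Quotient.mk _ K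

theorem LN.mk_eq_mk {K L : LocallyNormal G} :
    LN.mk K = LN.mk L ↔ Subgroup.Commensurable K.toSubgroup L.toSubgroup :=
  Quotient.eq

theorem LN.ind {p : LN G → Prop} (h : ∀ K, p (LN.mk K)) (α : LN G) : p α :=
  Quotient.ind h α

/-- The trivial subgroup is locally normal. -/
def LocallyNormal.trivial : LocallyNormal G where
  toSubgroup := ⊥
  isCompact := by simp
  isOpen_normalizer := by
    have h : Subgroup.normalizer ((⊥ : Subgroup G) : Set G) = ⊤ :=
      Subgroup.normalizer_eq_top_iff.2 inferInstance
    rw [h]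
    exact isOpen_univ

/-- A subgroup containing an open subgroup is open, so it suffices to bound the normaliser
from below. -/
theorem isOpen_normalizer_of_le [IsTopologicalGroup G] {K U : Subgroup G}
    (hU : IsOpen (U : Set G)) (h : U ≤ Subgroup.normalizer (K : Set G)) :
    IsOpen (Subgroup.normalizer (K : Set G) : Set G) :=
  Subgroup.isOpen_mono h hU

/-- A compact open subgroup is locally normal. -/
def LocallyNormal.ofOpen [IsTopologicalGroup G] (U : Subgroup G)
    (hc : IsCompact (U : Set G)) (ho : IsOpen (U : Set G)) : LocallyNormal G where
  toSubgroup := U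
  isCompact := hc
  isOpen_normalizer := isOpen_normalizer_of_le ho Subgroup.le_normalizer

variable [IsTopologicalGroup G] [T2Space G]

/-- The intersection of two locally normal subgroups is locally normal. -/
def LocallyNormal.inter (K L : LocallyNormal G) : LocallyNormal G where
  toSubgroup := K.toSubgroup ⊓ L.toSubgroup
  isCompact := by
    simpa using K.isCompact.inter L.isCompact
  isOpen_normalizer := by
    refine isOpen_normalizer_of_le
      (U := Subgroup.normalizer (K.toSubgroup : Set G) ⊓
        Subgroup.normalizer (L.toSubgroup : Set G)) ?_ ?_
    · simpa using K.isOpen_normalizer.inter L.isOpen_normalizer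
    · intro g hg
      rw [Subgroup.mem_inf, Subgroup.mem_normalizer_iff, Subgroup.mem_normalizer_iff] at hg
      rw [Subgroup.mem_normalizer_iff]
      intro x
      rw [Subgroup.mem_inf, Subgroup.mem_inf, hg.1 x, hg.2 x]

/-- The partial order on classes is induced by inclusion of representatives. -/
instance : LE (LN G) where
  le α β := ∃ K L : LocallyNormal G,
    LN.mk K = α ∧ LN.mk L = β ∧ K.toSubgroup ≤ L.toSubgroup

theorem LN.mk_le_mk {K L : LocallyNormal G} :
    LN.mk K ≤ LN.mk L ↔ L.toSubgroup.relIndex K.toSubgroup ≠ 0 := by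
  constructor
  · rintro ⟨K', L', hK, hL, h⟩
    rw [LN.mk_eq_mk] at hK hL
    refine Subgroup.relIndex_ne_zero_trans hL.2 (Subgroup.relIndex_ne_zero_trans ?_ hK.1)
    rw [Subgroup.relIndex_eq_one.2 h]
    exact one_ne_zero
  · intro h
    refine ⟨K.inter L, L, LN.mk_eq_mk.2 ⟨?_, ?_⟩, rfl, inf_le_right⟩
    · change (K.toSubgroup ⊓ L.toSubgroup).relIndex K.toSubgroup ≠ 0
      rwa [Subgroup.inf_relIndex_left]
    · change K.toSubgroup.relIndex (K.toSubgroup ⊓ L.toSubgroup) ≠ 0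
      rw [Subgroup.relIndex_eq_one.2 inf_le_left]
      exact one_ne_zero

instance : PartialOrder (LN G) where
  le_refl := LN.ind fun K => ⟨K, K, rfl, rfl, le_rfl⟩
  le_trans := LN.ind fun K => LN.ind fun L => LN.ind fun M => by
    rw [LN.mk_le_mk, LN.mk_le_mk, LN.mk_le_mk]
    exact fun h₁ h₂ => Subgroup.relIndex_ne_zero_trans h₂ h₁
  le_antisymm := LN.ind fun K => LN.ind fun L => by
    rw [LN.mk_le_mk, LN.mk_le_mk, LN.mk_eq_mk]
    exact fun h₁ h₂ => ⟨h₂, h₁⟩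

/-- The meet `α ∧ β`: the class of `K ∩ L`, where `K`, `L` represent `α`, `β`. -/
def LN.meet (α β : LN G) : LN G :=
  Quotient.map₂ LocallyNormal.inter (fun K K' hK L L' hL => by
    have hm : ∀ {A A' B B' : LocallyNormal G},
        Subgroup.Commensurable A.toSubgroup A'.toSubgroup →
        Subgroup.Commensurable B.toSubgroup B'.toSubgroup →
        (A.inter B).toSubgroup.relIndex (A'.inter B').toSubgroup ≠ 0 := by
      intro A A' B B' hA hB
      refine Subgroup.relIndex_inf_ne_zero ?_ ?_
      · refine Subgroup.relIndex_ne_zero_trans hA.1 ?_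
        rw [Subgroup.relIndex_eq_one.2
          (show (A'.inter B').toSubgroup ≤ A'.toSubgroup from inf_le_left)]
        exact one_ne_zero
      · refine Subgroup.relIndex_ne_zero_trans hB.1 ?_
        rw [Subgroup.relIndex_eq_one.2
          (show (A'.inter B').toSubgroup ≤ B'.toSubgroup from inf_le_right)]
        exact one_ne_zero
    exact ⟨hm hK hL, hm hK.symm hL.symm⟩) α β

theorem LN.meet_mk (K L : LocallyNormal G) :
    LN.meet (LN.mk K) (LN.mk L) = LN.mk (K.inter L) := rfl

instance : SemilatticeInf (LN G) where
  inf := LN.meet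
  inf_le_left := LN.ind fun K => LN.ind fun L =>
    ⟨K.inter L, K, rfl, rfl, inf_le_left⟩
  inf_le_right := LN.ind fun K => LN.ind fun L =>
    ⟨K.inter L, L, rfl, rfl, inf_le_right⟩
  le_inf := LN.ind fun K => LN.ind fun L => LN.ind fun M => by
    rw [LN.meet_mk, LN.mk_le_mk, LN.mk_le_mk, LN.mk_le_mk]
    exact Subgroup.relIndex_inf_ne_zero

/-- The minimum `0`: the class of the trivial subgroup. -/
instance : OrderBot (LN G) where
  bot := LN.mk LocallyNormal.trivial
  bot_le := LN.ind fun K => ⟨LocallyNormal.trivial, K, rfl, rfl, bot_le⟩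

end Order

section Action

variable {G : Type*} [Group G] [TopologicalSpace G] [IsTopologicalGroup G]

/-- The conjugate `g K g⁻¹` of a locally normal subgroup. -/
def LocallyNormal.conj (g : G) (K : LocallyNormal G) : LocallyNormal G where
  toSubgroup := MulAut.conj g • K.toSubgroup
  isCompact := by
    have hc : Continuous fun x : G => g * x * g⁻¹ := by fun_prop
    exact K.isCompact.image hc
  isOpen_normalizer := by
    have hc : Continuous fun x : G => g⁻¹ * x * g := by fun_prop
    have h := K.isOpen_normalizer.preimage hc
    convert h using 1
    ext x
    rw [SetLike.mem_coe, Set.mem_preimage, SetLike.mem_coe, Subgroup.mem_normalizer_iff,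
      Subgroup.mem_normalizer_iff]
    simp only [Subgroup.mem_pointwise_smul_iff_inv_smul_mem, ← map_inv, MulAut.smul_def,
      MulAut.conj_apply, inv_inv]
    constructor
    · intro H y
      have := H (g * y * g⁻¹)
      convert this using 2 <;> group
    · intro H y
      have := H (g⁻¹ * y * g)
      convert this using 2
      group

/-- `G` acts on the structure lattice by conjugation of representatives. -/
instance : MulAction G (LN G) where
  smul g α := Quotient.map (LocallyNormal.conj g)
    (fun _ _ h => Subgroup.Commensurable.conj h (ConjAct.toConjAct g)) α
  one_smul := LN.ind fun K => by
    refine LN.mk_eq_mk.2 ?_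
    have : (K.conj 1).toSubgroup = K.toSubgroup := by
      simp [LocallyNormal.conj]
    rw [this]
  mul_smul g h := LN.ind fun K => by
    refine LN.mk_eq_mk.2 ?_
    have : (K.conj (g * h)).toSubgroup = ((K.conj h).conj g).toSubgroup := by
      simp [LocallyNormal.conj, mul_smul]
    rw [this]

theorem LN.smul_mk (g : G) (K : LocallyNormal G) :
    g • LN.mk K = LN.mk (K.conj g) := rfl

end Action

section Centraliser

variable {G : Type*} [Group G] [TopologicalSpace G] [IsTopologicalGroup G] [T2Space G]

/-- The centraliser `C_U(K)`, for `U` a compact open subgroup normalising `K`,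
as a locally normal subgroup. -/
def LocallyNormal.cent (U : Subgroup G) (hc : IsCompact (U : Set G)) (ho : IsOpen (U : Set G))
    (K : LocallyNormal G) (hn : U ≤ Subgroup.normalizer (K.toSubgroup : Set G)) :
    LocallyNormal G where
  toSubgroup := U ⊓ Subgroup.centralizer (K.toSubgroup : Set G)
  isCompact := by
    have h : IsClosed (Subgroup.centralizer (K.toSubgroup : Set G) : Set G) :=
      Set.isClosed_centralizer _
    simpa using hc.inter_right h
  isOpen_normalizer := by
    refine isOpen_normalizer_of_le ho ?_
    have key : ∀ g ∈ U, ∀ x ∈ U ⊓ Subgroup.centralizer (K.toSubgroup : Set G),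
        g * x * g⁻¹ ∈ U ⊓ Subgroup.centralizer (K.toSubgroup : Set G) := by
      intro g hg x hx
      refine ⟨U.mul_mem (U.mul_mem hg hx.1) (U.inv_mem hg), ?_⟩
      refine Subgroup.mem_centralizer_iff.2 ?_
      intro k hk
      have hk' : g⁻¹ * k * g ∈ K.toSubgroup := by
        simpa using (Subgroup.mem_normalizer_iff.1 (hn (U.inv_mem hg)) k).1 hk
      have h := Subgroup.mem_centralizer_iff.1 hx.2 _ hk'
      calc k * (g * x * g⁻¹) = g * ((g⁻¹ * k * g) * x) * g⁻¹ := by group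
        _ = g * (x * (g⁻¹ * k * g)) * g⁻¹ := by rw [h]
        _ = g * x * g⁻¹ * k := by group
    intro g hg
    rw [Subgroup.mem_normalizer_iff]
    intro x
    refine ⟨key g hg x, fun hx => ?_⟩
    have h := key g⁻¹ (U.inv_mem hg) _ hx
    have e : g⁻¹ * (g * x * g⁻¹) * g⁻¹⁻¹ = x := by group
    rwa [e] at h

/-- `IsPerp α β`: there are a compact open subgroup `U` of `G` and a representative `K` of `α`
that is a (closed) normal subgroup of `U`, such that `β` is the class of `C_U(K)`. -/
def IsPerp (α β : LN G) : Prop :=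
  ∃ (U : Subgroup G) (hc : IsCompact (U : Set G)) (ho : IsOpen (U : Set G))
    (K : LocallyNormal G) (_ : K.toSubgroup ≤ U)
    (hn : U ≤ Subgroup.normalizer (K.toSubgroup : Set G)),
    LN.mk K = α ∧ β = LN.mk (K.cent U hc ho hn)

open Classical in
/-- The operator `α ↦ α^⊥`, which picks a class `β` with `IsPerp α β`.  For groups in `𝒮` there is
exactly one such `β`; this is part of the claim of the theorem.  The value `⊥` in the
`else` branch is never used for such groups. -/
noncomputable def perp (α : LN G) : LN G :=
  if h : ∃ β, IsPerp α β then h.choose else ⊥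

/-- The operator `α ∨' β = (α^⊥ ∧ β^⊥)^⊥`. -/
noncomputable def perpJoin (α β : LN G) : LN G :=
  perp (perp α ⊓ perp β)

variable (G) in
/-- The centraliser lattice `{α^⊥ | α ∈ LN(G)}`. -/
def LC : Set (LN G) := Set.range (perp : LN G → LN G)

end Centraliser

end TDLC

/-! The theorem reduces to one equivalence: `γ ⊓ α = ⊥ ↔ γ ≤ perp α`, that is, `perp` is a
pseudocomplement on the meet-semilattice `LN G`. By Glivenko's argument the elements `perp α` then
form a Boolean algebra. A pseudocomplement is determined by the order, which makes `perp`
independent of choices and equivariant under conjugation.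

In terms of representatives the equivalence concerns germs at `1`. If `M ∩ K = 1`, elements of `M`
close to `1` commute with `K` near `1`, and one must deduce that they centralise `K`. Conversely, a
subgroup of `K` centralising `K` must be trivial. Both follow from `eq_one_of_mem_quasiCentralizer`,
which rests on two facts about `G`: the quasi-centre is trivial, so discrete locally normal
subgroups are trivial (`eq_bot_of_inf_eq_bot`), and abelian locally normal subgroups are trivial
(`eq_bot_of_commute`).

Both facts come from `exists_inf_eq_bot`. If the germ of a compact `N` is conjugation invariant, its
germ quasi-centraliser is normal in `G`, so if nontrivial it is dense. Compact generation then lets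
finitely many of its elements, with a compact open `U` normalising `N`, generate `G`. These elements
commute with a small `N ∩ W`, which is therefore a compact normal subgroup of `G`, hence trivial.
For the quasi-centre take `N = U`; for an abelian `A`, let `N` be generated by small pieces of
finitely many conjugates of `A`. -/

namespace TDLC

/-! ### Boolean algebras from pseudocomplements -/

section PseudoComplement

variable {L : Type*} [SemilatticeInf L] [OrderBot L] {p : L → L}

/-- In a meet-semilattice with pseudocomplement `p`, the elements `p a` form a Boolean algebra. -/
@[reducible]
noncomputable def booleanAlgebraOfPseudocomplement (hp : ∀ a b, a ⊓ b = ⊥ ↔ a ≤ p b) :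
    BooleanAlgebra (Set.range p) :=
  have hp' : ∀ a b, b ⊓ a = ⊥ ↔ a ≤ p b := fun a b => by rw [inf_comm, hp]
  have hself : ∀ a, p a ⊓ a = ⊥ := fun a => (hp _ _).2 le_rfl
  have hdbl : ∀ a, a ≤ p (p a) := fun a => (hp' _ _).1 (hself a)
  have hanti : ∀ {a b}, a ≤ b → p b ≤ p a := fun {a b} h =>
    (hp _ _).1 (le_bot_iff.1 ((inf_le_inf_left _ h).trans (hself b).le))
  have hreg : ∀ a ∈ Set.range p, p (p a) = a := by
    rintro _ ⟨b, rfl⟩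
    exact le_antisymm (hanti (hdbl b)) (hdbl _)
  have hle : ∀ a, ∀ b ∈ Set.range p, a ≤ b ↔ a ⊓ p b = ⊥ := fun a b hb => by
    rw [hp, hreg b hb]
  have hinf : ∀ a ∈ Set.range p, ∀ b ∈ Set.range p, a ⊓ b ∈ Set.range p := by
    intro a ha b hb
    refine ⟨p (a ⊓ b), le_antisymm (le_inf ?_ ?_) (hdbl _)⟩
    · exact (hanti (hanti inf_le_left)).trans (hreg a ha).le
    · exact (hanti (hanti inf_le_right)).trans (hreg b hb).le
  have htop : ∀ a, a ≤ p ⊥ := fun a => (hp _ _).1 (inf_bot_eq a)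
  have hbot : p (p ⊥) = ⊥ := by
    have h := hself (p ⊥)
    rwa [inf_eq_left.2 (htop _)] at h
  { (inferInstance : PartialOrder (Set.range p)) with
    sup := fun a b => ⟨p (p a ⊓ p b), _, rfl⟩
    inf := fun a b => ⟨a ⊓ b, hinf _ a.2 _ b.2⟩
    compl := fun a => ⟨p a, _, rfl⟩
    top := ⟨p ⊥, _, rfl⟩
    bot := ⟨⊥, _, hbot⟩
    le_sup_left := fun a b => (hdbl a.1).trans (hanti inf_le_left)
    le_sup_right := fun a b => (hdbl b.1).trans (hanti inf_le_right)
    sup_le := fun a b c h₁ h₂ =>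
      (hanti (le_inf (hanti h₁) (hanti h₂))).trans (hreg c.1 c.2).le
    inf_le_left := fun a b => (inf_le_left : a.1 ⊓ b.1 ≤ a.1)
    inf_le_right := fun a b => (inf_le_right : a.1 ⊓ b.1 ≤ b.1)
    le_inf := fun a b c h₁ h₂ => (le_inf h₁ h₂ : a.1 ≤ b.1 ⊓ c.1)
    le_sup_inf := by
      intro a b c
      change p (p a.1 ⊓ p b.1) ⊓ p (p a.1 ⊓ p c.1) ≤ p (p a.1 ⊓ p (b.1 ⊓ c.1))
      set x := p (p a.1 ⊓ p b.1) ⊓ p (p a.1 ⊓ p c.1) with hx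
      -- Distributivity: since `b` is regular, `y ≤ b` amounts to `y ⊓ p b = ⊥`, which turns this
      -- into the left-hand factor of `x`.
      have h₁ : x ⊓ p a.1 ≤ b.1 := by
        rw [hle _ _ b.2, inf_assoc, hp]
        exact inf_le_left
      have h₂ : x ⊓ p a.1 ≤ c.1 := by
        rw [hle _ _ c.2, inf_assoc, hp]
        exact inf_le_right
      rw [← hp, ← inf_assoc, ← hle _ _ (hinf _ b.2 _ c.2)]
      exact le_inf h₁ h₂
    inf_compl_le_bot := fun a => by
      change a.1 ⊓ p a.1 ≤ ⊥
      rw [inf_comm, hself]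
    top_le_sup_compl := fun a => by
      change p ⊥ ≤ p (p a.1 ⊓ p (p a.1))
      rw [inf_comm, hself]
    le_top := fun a => htop a.1
    bot_le := fun a => (bot_le : ⊥ ≤ a.1)
    sdiff_eq := fun _ _ => rfl
    himp_eq := fun _ _ => rfl }

end PseudoComplement

open Filter Topology

/-! ### Normalisers, centralisers and commuting subgroups -/

variable {G : Type*} [Group G]

theorem mul_mul_inv_mem_of_mem_normalizer {K : Subgroup G} {g : G}
    (hg : g ∈ Subgroup.normalizer (K : Set G)) {x : G} (hx : x ∈ K) : g * x * g⁻¹ ∈ K :=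
  (Subgroup.mem_normalizer_iff.1 hg x).1 hx

theorem inv_mul_mul_mem_of_mem_normalizer {K : Subgroup G} {g : G}
    (hg : g ∈ Subgroup.normalizer (K : Set G)) {x : G} (hx : x ∈ K) : g⁻¹ * x * g ∈ K := by
  simpa using mul_mul_inv_mem_of_mem_normalizer (inv_mem hg) hx

theorem le_normalizer_of_conj_mem {K U : Subgroup G}
    (h : ∀ g ∈ U, ∀ x ∈ K, g * x * g⁻¹ ∈ K) : U ≤ Subgroup.normalizer (K : Set G) := by
  intro g hg
  refine Subgroup.mem_normalizer_iff.2 fun x => ⟨h g hg x, fun hx => ?_⟩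
  have := h g⁻¹ (inv_mem hg) _ hx
  simpa [mul_assoc] using this

theorem le_normalizer_inf {K L U : Subgroup G} (hK : U ≤ Subgroup.normalizer (K : Set G))
    (hL : U ≤ Subgroup.normalizer (L : Set G)) :
    U ≤ Subgroup.normalizer ((K ⊓ L : Subgroup G) : Set G) :=
  le_normalizer_of_conj_mem fun _ hg _ hx =>
    ⟨mul_mul_inv_mem_of_mem_normalizer (hK hg) hx.1,
      mul_mul_inv_mem_of_mem_normalizer (hL hg) hx.2⟩

theorem le_normalizer_centralizer {K U : Subgroup G}
    (hK : U ≤ Subgroup.normalizer (K : Set G)) :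
    U ≤ Subgroup.normalizer (Subgroup.centralizer (K : Set G) : Set G) :=
  le_normalizer_of_conj_mem fun g hg x hx => by
    refine Subgroup.mem_centralizer_iff.2 fun k hk => ?_
    have h := Subgroup.mem_centralizer_iff.1 hx _
      (inv_mul_mul_mem_of_mem_normalizer (hK hg) hk)
    calc k * (g * x * g⁻¹) = g * ((g⁻¹ * k * g) * x) * g⁻¹ := by group
      _ = g * (x * (g⁻¹ * k * g)) * g⁻¹ := by rw [h]
      _ = g * x * g⁻¹ * k := by group

/-- If `k` and `m` have their commutator in `K` and in `M`, which meet trivially, they commute. -/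
theorem commute_of_inf_eq_bot {K M : Subgroup G} (h : K ⊓ M = ⊥) {k m : G}
    (hk : k ∈ K) (hm : m ∈ M) (hkM : k ∈ Subgroup.normalizer (M : Set G))
    (hmK : m ∈ Subgroup.normalizer (K : Set G)) : k * m = m * k := by
  have h₁ : k * m * k⁻¹ * m⁻¹ ∈ K := by
    have := K.mul_mem hk (mul_mul_inv_mem_of_mem_normalizer hmK (K.inv_mem hk))
    simpa [mul_assoc] using this
  have h₂ : k * m * k⁻¹ * m⁻¹ ∈ M :=
    M.mul_mem (mul_mul_inv_mem_of_mem_normalizer hkM hm) (M.inv_mem hm)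
  have h₃ : k * m * k⁻¹ * m⁻¹ ∈ K ⊓ M := ⟨h₁, h₂⟩
  rw [h, Subgroup.mem_bot, mul_inv_eq_one, mul_inv_eq_iff_eq_mul] at h₃
  exact h₃

/-- In a finite family of commutative subgroups normalised by `V`, containing a nontrivial member
`A ≤ V`, there is a nontrivial subgroup of `A` that commutes with every member. -/
theorem exists_le_forall_commute {V : Subgroup G} {A : Subgroup G}
    (hA : A ≠ ⊥) (hVA : V ≤ Subgroup.normalizer (A : Set G)) (hAV : A ≤ V)
    {𝓑 : Set (Subgroup G)} (hfin : 𝓑.Finite)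
    (h𝓑 : ∀ B ∈ 𝓑, B ≤ V ∧ V ≤ Subgroup.normalizer (B : Set G) ∧
      ∀ x ∈ B, ∀ y ∈ B, x * y = y * x) :
    ∃ C ≤ A, C ≠ ⊥ ∧ ∀ B ∈ 𝓑, ∀ c ∈ C, ∀ b ∈ B, c * b = b * c := by
  suffices h : ∃ C ≤ A, C ≠ ⊥ ∧ V ≤ Subgroup.normalizer (C : Set G) ∧
      ∀ B ∈ 𝓑, ∀ c ∈ C, ∀ b ∈ B, c * b = b * c by
    obtain ⟨C, hCA, hC, -, h⟩ := h
    exact ⟨C, hCA, hC, h⟩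
  induction 𝓑, hfin using Set.Finite.induction_on with
  | empty => exact ⟨A, le_rfl, hA, hVA, by simp⟩
  | @insert B 𝓑 _ _ ih =>
    obtain ⟨C, hCA, hC, hVC, hcomm⟩ := ih fun B' hB' => h𝓑 B' (Set.mem_insert_of_mem _ hB')
    obtain ⟨hBV, hVB, hB⟩ := h𝓑 B (Set.mem_insert _ _)
    -- Either `C` and `B` commute because they meet trivially and normalise each other, or `C`
    -- shrinks to `C ⊓ B`, which commutes with the abelian `B`.
    by_cases h : C ⊓ B = ⊥
    · refine ⟨C, hCA, hC, hVC, ?_⟩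
      rintro B' (rfl | hB') c hc b hb
      · exact commute_of_inf_eq_bot h hc hb (hVB (hAV (hCA hc))) (hVC (hBV hb))
      · exact hcomm B' hB' c hc b hb
    · refine ⟨C ⊓ B, inf_le_left.trans hCA, h, le_normalizer_inf hVC hVB, ?_⟩
      rintro B' (rfl | hB') c hc b hb
      · exact hB c hc.2 b hb
      · exact hcomm B' hB' c hc.1 b hb

variable [TopologicalSpace G]

theorem eventually_mem_of_isOpen {U : Subgroup G} (hU : IsOpen (U : Set G)) :
    ∀ᶠ x in 𝓝 (1 : G), x ∈ U := hU.mem_nhds U.one_mem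

variable [IsTopologicalGroup G]

theorem tendsto_conj_nhds_one (g : G) : Tendsto (fun x => g * x * g⁻¹) (𝓝 1) (𝓝 1) := by
  have h : Continuous fun x : G => g * x * g⁻¹ := by fun_prop
  simpa using h.tendsto 1

theorem tendsto_inv_conj_nhds_one (g : G) : Tendsto (fun x => g⁻¹ * x * g) (𝓝 1) (𝓝 1) := by
  simpa using tendsto_conj_nhds_one g⁻¹

section VanDantzig

/-- For a compact set `U`, an open neighbourhood of `1` contains all `U`-conjugates of elements
near `1`. -/
theorem eventually_forall_conj_mem {U O : Set G} (hU : IsCompact U) (hO : O ∈ 𝓝 (1 : G)) :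
    ∀ᶠ x in 𝓝 (1 : G), ∀ u ∈ U, u * x * u⁻¹ ∈ O := by
  refine hU.eventually_forall_of_forall_eventually fun u _ => ?_
  have hc : Continuous fun z : G × G => z.2 * z.1 * z.2⁻¹ := by fun_prop
  have h := hc.tendsto (1, u)
  simp only [mul_one, mul_inv_cancel] at h
  exact h hO

/-- An open subgroup contains an open subgroup normalised by a given compact open subgroup. -/
theorem exists_isOpen_le_normalizer {U : Subgroup G} (hc : IsCompact (U : Set G))
    (ho : IsOpen (U : Set G)) {V : Subgroup G} (hV : IsOpen (V : Set G)) :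
    ∃ W : Subgroup G, W ≤ U ∧ W ≤ V ∧ IsOpen (W : Set G) ∧
      U ≤ Subgroup.normalizer (W : Set G) := by
  -- The largest subgroup of `U ⊓ V` normalised by `U`; compactness of `U` keeps it open.
  let W : Subgroup G :=
    { carrier := {x | x ∈ U ∧ ∀ u ∈ U, u * x * u⁻¹ ∈ V}
      one_mem' := ⟨U.one_mem, fun u _ => by simp⟩
      mul_mem' := fun {a b} ha hb => ⟨U.mul_mem ha.1 hb.1, fun u hu => by
        simpa [mul_assoc] using V.mul_mem (ha.2 u hu) (hb.2 u hu)⟩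
      inv_mem' := fun {a} ha => ⟨U.inv_mem ha.1, fun u hu => by
        simpa [mul_assoc] using V.inv_mem (ha.2 u hu)⟩ }
  refine ⟨W, fun x hx => hx.1, fun x hx => by simpa using hx.2 1 U.one_mem, ?_, ?_⟩
  · refine Subgroup.isOpen_of_mem_nhds W (g := 1) ?_
    exact (eventually_mem_of_isOpen ho).and
      (eventually_forall_conj_mem hc (eventually_mem_of_isOpen hV))
  · refine le_normalizer_of_conj_mem fun g hg x hx => ⟨?_, fun u hu => ?_⟩
    · exact U.mul_mem (U.mul_mem hg hx.1) (U.inv_mem hg)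
    · simpa [mul_assoc] using hx.2 (u * g) (U.mul_mem hu hg)

variable [T2Space G]

/-- Van Dantzig's theorem. -/
theorem exists_isCompact_isOpen_subgroup [LocallyCompactSpace G] [TotallyDisconnectedSpace G]
    {O : Set G} (hO : O ∈ 𝓝 (1 : G)) :
    ∃ U : Subgroup G, IsCompact (U : Set G) ∧ IsOpen (U : Set G) ∧ (U : Set G) ⊆ O := by
  obtain ⟨C, hC, hCO, hCc⟩ := local_compact_nhds hO
  obtain ⟨W, hW, hWo, hWC⟩ :=
    (loc_compact_Haus_tot_disc_of_zero_dim (H := G)).mem_nhds_iff.1 hC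
  have hWc : IsCompact W := hCc.of_isClosed_subset hW.1 hWC
  -- The stabiliser of the compact open set `W` under left translation; it lies in `W` because `1 ∈
  -- W`.
  let H : Subgroup G :=
    { carrier := {x | ∀ w ∈ W, x * w ∈ W ∧ x⁻¹ * w ∈ W}
      one_mem' := fun w hw => by simpa using hw
      mul_mem' := fun {a b} ha hb w hw => by
        rw [mul_assoc, mul_inv_rev, mul_assoc]
        exact ⟨(ha _ (hb w hw).1).1, (hb _ (ha w hw).2).2⟩
      inv_mem' := fun {a} ha w hw => by
        rw [inv_inv]
        exact (ha w hw).symm }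
  have hHo : IsOpen (H : Set G) := by
    refine Subgroup.isOpen_of_mem_nhds H (g := 1) ?_
    refine hWc.eventually_forall_of_forall_eventually fun w hw => ?_
    have hc : Continuous fun z : G × G => (z.1 * z.2, z.1⁻¹ * z.2) := by fun_prop
    have h := hc.tendsto (1, w)
    simp only [one_mul, inv_one] at h
    exact h ((hW.2.prod hW.2).mem_nhds ⟨hw, hw⟩)
  have hHW : (H : Set G) ⊆ W := fun x hx => by simpa using (hx 1 hWo).1
  exact ⟨H, hWc.of_isClosed_subset (H.isClosed_of_isOpen hHo) hHW, hHo,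
    (hHW.trans hWC).trans hCO⟩

theorem exists_isOpen_subgroup_of_eventually [LocallyCompactSpace G]
    [TotallyDisconnectedSpace G] {P : G → Prop} (h : ∀ᶠ x in 𝓝 (1 : G), P x) :
    ∃ U : Subgroup G, IsCompact (U : Set G) ∧ IsOpen (U : Set G) ∧ ∀ x ∈ U, P x :=
  exists_isCompact_isOpen_subgroup h

end VanDantzig

/-- A compactly generated group is generated by an open subgroup together with finitely many
elements of a given set that generates a dense subgroup. -/
theorem exists_finset_closure_eq_top {S : Set G} (hS : IsCompact S)
    (hgen : Subgroup.closure S = ⊤) {U : Subgroup G} (hU : IsOpen (U : Set G)) {T : Set G}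
    (hT : Dense (Subgroup.closure T : Set G)) :
    ∃ F : Finset G, (F : Set G) ⊆ T ∧ Subgroup.closure ((U : Set G) ∪ F) = ⊤ := by
  classical
  let H : {F : Finset G // (F : Set G) ⊆ T} → Subgroup G :=
    fun F => Subgroup.closure ((U : Set G) ∪ F.1)
  have hUH : ∀ F, U ≤ H F := fun F x hx => Subgroup.subset_closure (Or.inl hx)
  have hHo : ∀ F, IsOpen (H F : Set G) := fun F => Subgroup.isOpen_mono (hUH F) hU
  have hdir : Directed (· ≤ ·) H := by
    intro F F'
    refine ⟨⟨F.1 ∪ F'.1, by simpa using ⟨F.2, F'.2⟩⟩, Subgroup.closure_mono ?_,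
      Subgroup.closure_mono ?_⟩
    · exact Set.union_subset_union_right _ (by simp)
    · exact Set.union_subset_union_right _ (by simp)
  have : Nonempty {F : Finset G // (F : Set G) ⊆ T} := ⟨⟨∅, by simp⟩⟩
  have htop : ⨆ F, H F = ⊤ := by
    have ho : IsOpen ((⨆ F, H F : Subgroup G) : Set G) :=
      Subgroup.isOpen_mono (le_iSup H ⟨∅, by simp⟩) (hHo _)
    have hTle : Subgroup.closure T ≤ ⨆ F, H F := by
      rw [Subgroup.closure_le]
      intro t ht
      exact le_iSup H ⟨{t}, by simpa using ht⟩ (Subgroup.subset_closure (Or.inr (by simp)))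
    -- The union is an open subgroup, hence closed, and contains a dense set; compactness of `S`
    -- then picks out one member of the directed family.
    rw [eq_top_iff]
    intro x _
    have := closure_minimal hTle (Subgroup.isClosed_of_isOpen _ ho)
    exact this (hT x)
  obtain ⟨F, hF⟩ := hS.elim_directed_cover (fun F => (H F : Set G)) hHo (by
    intro x _
    have hx : x ∈ ⨆ F, H F := htop ▸ Subgroup.mem_top x
    simpa using (Subgroup.mem_iSup_of_directed hdir).1 hx) hdir
  refine ⟨F.1, F.2, ?_⟩
  rw [eq_top_iff, ← hgen, Subgroup.closure_le]
  exact hF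

/-! ### Germs of subgroups at the identity -/

/-- The germ quasi-centraliser of `K`: the elements commuting with all elements of `K` that are
close to `1`. -/
def quasiCentralizer (K : Subgroup G) : Subgroup G where
  carrier := {g | ∀ᶠ x in 𝓝 (1 : G), x ∈ K → g * x = x * g}
  one_mem' := by simp
  mul_mem' := fun {a b} ha hb => by
    filter_upwards [ha, hb] with x hxa hxb hx
    rw [mul_assoc, hxb hx, ← mul_assoc, hxa hx, mul_assoc]
  inv_mem' := fun {a} ha => by
    filter_upwards [ha] with x hxa hx
    rw [inv_mul_eq_iff_eq_mul, ← mul_assoc, hxa hx, mul_assoc, mul_inv_cancel, mul_one]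

/-- The elements `g` such that `K` and `g⁻¹ K g` coincide near `1`. -/
def localNormalizer (K : Subgroup G) : Subgroup G where
  carrier := {g | ∀ᶠ x in 𝓝 (1 : G), x ∈ K ↔ g * x * g⁻¹ ∈ K}
  one_mem' := by simp
  mul_mem' := fun {a b} ha hb => by
    filter_upwards [hb, (tendsto_conj_nhds_one b).eventually ha] with x hxb hxa
    rw [hxb, hxa]
    simp [mul_assoc]
  inv_mem' := fun {a} ha => by
    filter_upwards [(tendsto_inv_conj_nhds_one a).eventually ha] with x hx
    rw [inv_inv, hx]
    simp [mul_assoc]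

theorem normalizer_le_localNormalizer (K : Subgroup G) :
    Subgroup.normalizer (K : Set G) ≤ localNormalizer K := fun _ hg =>
  Eventually.of_forall (Subgroup.mem_normalizer_iff.1 hg)

theorem mem_localNormalizer_of_eventually {K : Subgroup G} {g : G}
    (h₁ : ∀ᶠ x in 𝓝 (1 : G), x ∈ K → g * x * g⁻¹ ∈ K)
    (h₂ : ∀ᶠ x in 𝓝 (1 : G), x ∈ K → g⁻¹ * x * g ∈ K) : g ∈ localNormalizer K := by
  filter_upwards [h₁, (tendsto_conj_nhds_one g).eventually h₂] with x hx₁ hx₂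
  refine ⟨hx₁, fun h => ?_⟩
  simpa [mul_assoc] using hx₂ h

theorem conj_mem_quasiCentralizer {K : Subgroup G} {g h : G} (hg : g ∈ quasiCentralizer K)
    (hh : h ∈ localNormalizer K) : h * g * h⁻¹ ∈ quasiCentralizer K := by
  have hh' : ∀ᶠ x in 𝓝 (1 : G), x ∈ K ↔ h⁻¹ * x * h⁻¹⁻¹ ∈ K := (localNormalizer K).inv_mem hh
  filter_upwards [hh', (tendsto_inv_conj_nhds_one h).eventually hg] with x hx₁ hx₂ hx
  have := hx₂ (by simpa using hx₁.1 hx)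
  calc h * g * h⁻¹ * x = h * (g * (h⁻¹ * x * h)) * h⁻¹ := by group
    _ = h * ((h⁻¹ * x * h) * g) * h⁻¹ := by rw [this]
    _ = x * (h * g * h⁻¹) := by group

theorem relIndex_ne_zero_of_isOpen {K V : Subgroup G} (hK : IsCompact (K : Set G))
    (hV : IsOpen (V : Set G)) : V.relIndex K ≠ 0 := by
  have : CompactSpace K := isCompact_iff_compactSpace.1 hK
  have : Finite (K ⧸ V.subgroupOf K) :=
    Subgroup.quotient_finite_of_isOpen _ (hV.preimage continuous_subtype_val)
  exact Subgroup.index_ne_zero_of_finite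

/-- A closed subgroup of finite index is open. This turns commensurability into agreement of germs.
-/
theorem eventually_mem_of_relIndex_ne_zero {K L : Subgroup G} (hL : IsClosed (L : Set G))
    (h : L.relIndex K ≠ 0) : ∀ᶠ x in 𝓝 (1 : G), x ∈ K → x ∈ L := by
  have : (L.subgroupOf K).FiniteIndex := ⟨h⟩
  have ho : IsOpen (L.subgroupOf K : Set K) :=
    Subgroup.isOpen_of_isClosed_of_finiteIndex _ (hL.preimage continuous_subtype_val)
  obtain ⟨O, hO, hOK⟩ := isOpen_induced_iff.1 ho
  have h1 : (1 : G) ∈ O := by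
    have : (1 : K) ∈ Subtype.val ⁻¹' O := hOK ▸ (L.subgroupOf K).one_mem
    exact this
  filter_upwards [hO.mem_nhds h1] with x hx hxK
  have : (⟨x, hxK⟩ : K) ∈ (L.subgroupOf K : Set K) := hOK ▸ hx
  exact this

namespace MemS

variable (hG : MemS G)
include hG

theorem bot_not_isOpen : ¬ IsOpen ((⊥ : Subgroup G) : Set G) := fun h =>
  hG.nonDiscrete (discreteTopology_of_isOpen_singleton_one (by simpa using h))

/-- If `T` generates a nontrivial normal subgroup, then any open subgroup together with finitely
many elements of `T` generates `G`. -/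
theorem exists_finset {U : Subgroup G} (hU : IsOpen (U : Set G)) {T : Set G}
    (hT : (Subgroup.closure T).Normal) (hT' : Subgroup.closure T ≠ ⊥) :
    ∃ F : Finset G, (F : Set G) ⊆ T ∧ Subgroup.closure ((U : Set G) ∪ F) = ⊤ := by
  obtain ⟨S, hS, hgen⟩ := hG.compactlyGenerated
  refine exists_finset_closure_eq_top hS hgen hU ?_
  have h := (hG.topologicallySimple _ (Subgroup.is_normal_topologicalClosure _)
    (Subgroup.isClosed_topologicalClosure (Subgroup.closure T))).resolve_left fun h =>
      hT' (le_bot_iff.1 (h ▸ Subgroup.le_topologicalClosure _))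
  intro x
  have hx : x ∈ (Subgroup.closure T).topologicalClosure := h ▸ Subgroup.mem_top x
  exact hx

end MemS

/-! ### Conjugation on the structure lattice -/

theorem LN.smul_le_smul {α β : LN G} (g : G) (h : α ≤ β) : g • α ≤ g • β := by
  obtain ⟨K, L, rfl, rfl, hKL⟩ := h
  exact ⟨K.conj g, L.conj g, rfl, rfl, Subgroup.pointwise_smul_le_pointwise_smul_iff.2 hKL⟩

theorem LN.smul_le_smul_iff {α β : LN G} (g : G) : g • α ≤ g • β ↔ α ≤ β :=
  ⟨fun h => by simpa using LN.smul_le_smul g⁻¹ h, LN.smul_le_smul g⟩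

theorem LN.le_smul_iff {α β : LN G} (g : G) : α ≤ g • β ↔ g⁻¹ • α ≤ β := by
  rw [← LN.smul_le_smul_iff g⁻¹, inv_smul_smul]

variable [T2Space G]

theorem LN.smul_inf (g : G) (α β : LN G) : g • (α ⊓ β) = g • α ⊓ g • β :=
  eq_of_forall_le_iff fun γ => by simp only [le_inf_iff, LN.le_smul_iff]

theorem LN.smul_bot (g : G) : g • (⊥ : LN G) = ⊥ :=
  le_bot_iff.1 (by simpa using LN.smul_le_smul g (bot_le : ⊥ ≤ g⁻¹ • (⊥ : LN G)))

/-! ### Discrete and abelian locally normal subgroups are trivial -/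

namespace MemS

variable (hG : MemS G)
include hG

theorem exists_subgroup {P : G → Prop} (h : ∀ᶠ x in 𝓝 (1 : G), P x) :
    ∃ U : Subgroup G, IsCompact (U : Set G) ∧ IsOpen (U : Set G) ∧ ∀ x ∈ U, P x :=
  have := hG.locallyCompact
  have := hG.totallyDisconnected
  exists_isOpen_subgroup_of_eventually h

/-- Otherwise `G` itself would be compact, hence would have arbitrarily small open normal subgroups,
against simplicity and non-discreteness. -/
theorem eq_bot_of_isCompact_of_normal {N : Subgroup G} (hN : N.Normal)
    (hc : IsCompact (N : Set G)) : N = ⊥ := by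
  refine (hG.topologicallySimple N hN hc.isClosed).resolve_right ?_
  rintro rfl
  have := hG.nontrivial
  obtain ⟨x, hx⟩ := exists_ne (1 : G)
  obtain ⟨V, -, hVo, hV⟩ := hG.exists_subgroup (isOpen_ne.mem_nhds hx.symm)
  obtain ⟨W, -, hWV, hWo, hW⟩ := exists_isOpen_le_normalizer hc isOpen_univ hVo
  rcases hG.topologicallySimple W (Subgroup.normalizer_eq_top_iff.1 (top_le_iff.1 hW))
    (W.isClosed_of_isOpen hWo) with rfl | rfl
  · exact hG.bot_not_isOpen hWo
  · exact hV x (hWV (Subgroup.mem_top x)) rfl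

/-- A compact subgroup with open normaliser whose germ at `1` is invariant under conjugation is
discrete as soon as its germ quasi-centraliser is nontrivial. -/
theorem exists_inf_eq_bot {N U : Subgroup G} (hN : IsCompact (N : Set G))
    (hc : IsCompact (U : Set G)) (ho : IsOpen (U : Set G))
    (hUN : U ≤ Subgroup.normalizer (N : Set G)) (hloc : localNormalizer N = ⊤)
    (hne : quasiCentralizer N ≠ ⊥) :
    ∃ W : Subgroup G, IsOpen (W : Set G) ∧ N ⊓ W = ⊥ := by
  have hnorm : (quasiCentralizer N).Normal :=
    ⟨fun g hg h => conj_mem_quasiCentralizer hg (hloc ▸ Subgroup.mem_top h)⟩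
  obtain ⟨F, hF, hgen⟩ := hG.exists_finset (T := (quasiCentralizer N : Set G)) ho
    (by rwa [Subgroup.closure_eq]) (by rwa [Subgroup.closure_eq])
  have hev : ∀ᶠ x in 𝓝 (1 : G), ∀ f ∈ F, x ∈ N → f * x = x * f :=
    (Finset.eventually_all F).2 fun f hf => hF hf
  obtain ⟨V, -, hVo, hV⟩ := hG.exists_subgroup hev
  obtain ⟨W, hWU, hWV, hWo, hW⟩ := exists_isOpen_le_normalizer hc ho hVo
  refine ⟨W, hWo, hG.eq_bot_of_isCompact_of_normal ?_ ?_⟩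
  · rw [← Subgroup.normalizer_eq_top_iff, eq_top_iff, ← hgen, Subgroup.closure_le]
    rintro x (hx | hx)
    · exact le_normalizer_inf hUN hW hx
    · have key : ∀ y ∈ N ⊓ W, x * y * x⁻¹ = y := fun y hy => by
        rw [hV y (hWV hy.2) x hx hy.1, mul_inv_cancel_right]
      refine le_normalizer_of_conj_mem (U := Subgroup.zpowers x) ?_ (Subgroup.mem_zpowers x)
      intro g hg y hy
      have hxy : Subgroup.zpowers x ≤ Subgroup.centralizer {y} := by
        rw [Subgroup.zpowers_le, Subgroup.mem_centralizer_singleton_iff]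
        exact (mul_inv_eq_iff_eq_mul.1 (key y hy))
      have := Subgroup.mem_centralizer_singleton_iff.1 (hxy hg)
      rwa [this, mul_inv_cancel_right]
  · simpa using hN.inter_right (W.isClosed_of_isOpen hWo)

/-- The quasi-centre is trivial. -/
theorem eq_one_of_eventually_commute {g : G} (hg : ∀ᶠ x in 𝓝 (1 : G), g * x = x * g) :
    g = 1 := by
  obtain ⟨U, hc, ho, -⟩ := hG.exists_subgroup (P := fun _ => True) (by simp)
  by_contra hne
  obtain ⟨W, hWo, hW⟩ := hG.exists_inf_eq_bot hc hc ho Subgroup.le_normalizer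
    (eq_top_iff.2 fun h _ => by
      have h₁ := eventually_mem_of_isOpen ho
      filter_upwards [h₁, (tendsto_conj_nhds_one h).eventually h₁] with x hx hx'
      simp [hx, hx'])
    (fun h => hne (Subgroup.mem_bot.1 (h ▸ (hg.mono fun x hx _ => hx :
      g ∈ quasiCentralizer U))))
  refine hG.bot_not_isOpen ?_
  rw [← hW]
  exact ho.inter hWo

/-- A discrete subgroup with open normaliser is trivial. -/
theorem eq_bot_of_inf_eq_bot {K W : Subgroup G}
    (hK : IsOpen (Subgroup.normalizer (K : Set G) : Set G)) (hW : IsOpen (W : Set G))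
    (h : K ⊓ W = ⊥) : K = ⊥ := by
  rw [eq_bot_iff]
  intro x hx
  refine Subgroup.mem_bot.2 (hG.eq_one_of_eventually_commute ?_)
  -- For `u` near `1` the commutator lies in `K` and in `W`, so it is trivial and `x` is in the
  -- quasi-centre.
  have hc : Continuous fun u : G => x * u * x⁻¹ * u⁻¹ := by fun_prop
  have ht := hc.tendsto 1
  simp only [mul_one, mul_inv_cancel, inv_one] at ht
  filter_upwards [eventually_mem_of_isOpen hK, ht.eventually (eventually_mem_of_isOpen hW)]
    with u hu hu'
  have hmem : x * u * x⁻¹ * u⁻¹ ∈ K ⊓ W := by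
    refine ⟨?_, hu'⟩
    simpa [mul_assoc] using
      K.mul_mem hx (mul_mul_inv_mem_of_mem_normalizer hu (K.inv_mem hx))
  rw [h, Subgroup.mem_bot, mul_inv_eq_one, mul_inv_eq_iff_eq_mul] at hmem
  exact hmem

/-- There are no nontrivial commutative locally normal subgroups. -/
theorem eq_bot_of_commute {A : Subgroup G} (hA : IsCompact (A : Set G))
    (hAo : IsOpen (Subgroup.normalizer (A : Set G) : Set G))
    (hcomm : ∀ x ∈ A, ∀ y ∈ A, x * y = y * x) : A = ⊥ := by
  by_contra hne
  obtain ⟨U, hUc, hUo, hUA⟩ := hG.exists_subgroup (eventually_mem_of_isOpen hAo)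
  obtain ⟨F, hF, hgen⟩ := hG.exists_finset (T := Group.conjugatesOfSet (A : Set G)) hUo
    (Subgroup.normalClosure_normal (s := (A : Set G)))
    (fun h => hne (le_bot_iff.1 (h ▸ Subgroup.subset_normalClosure)))
  have hF' : ∀ f ∈ F, ∃ g : G, g⁻¹ * f * g ∈ A := by
    intro f hf
    obtain ⟨a, ha, hfa⟩ := Group.mem_conjugatesOfSet_iff.1 (hF hf)
    obtain ⟨g, rfl⟩ := isConj_iff.1 hfa
    exact ⟨g, by simpa [mul_assoc] using ha⟩
  choose! c hcA using hF'
  let B : G → Subgroup G := fun g => ((⟨A, hA, hAo⟩ : LocallyNormal G).conj g).toSubgroup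
  have hB : ∀ g x, x ∈ B g ↔ g⁻¹ * x * g ∈ A := fun g x => by
    simp only [B, LocallyNormal.conj, Subgroup.mem_pointwise_smul_iff_inv_smul_mem, ← map_inv,
      MulAut.smul_def, MulAut.conj_apply, inv_inv]
  have hBo : ∀ g, IsOpen (Subgroup.normalizer (B g : Set G) : Set G) := fun g =>
    LocallyNormal.isOpen_normalizer _
  classical
  let C : Finset G := insert 1 (F.image c)
  have hev : ∀ᶠ x in 𝓝 (1 : G), ∀ g ∈ C, x ∈ Subgroup.normalizer (B g : Set G) :=
    (Finset.eventually_all C).2 fun g _ => eventually_mem_of_isOpen (hBo g)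
  obtain ⟨V₀, -, hV₀o, hV₀⟩ := hG.exists_subgroup hev
  obtain ⟨V, hVU, hVV₀, hVo, hUV⟩ := exists_isOpen_le_normalizer hUc hUo hV₀o
  have hVB : ∀ g ∈ C, V ≤ Subgroup.normalizer (B g : Set G) := fun g hg x hx =>
    hV₀ x (hVV₀ hx) g hg
  have hVc : IsCompact (V : Set G) := hUc.of_isClosed_subset (V.isClosed_of_isOpen hVo) hVU
  -- Cutting the `U`-conjugates of each `B g` down to `V` makes them normalise one another. As `V`
  -- normalises `B g`, `E g u` depends only on the coset `u V`, so the family is finite and `U`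
  -- permutes it.
  let E : G → G → Subgroup G := fun g u => B (u * g) ⊓ V
  have hEconj : ∀ g, ∀ u, ∀ v ∈ U, ∀ x ∈ E g u, v * x * v⁻¹ ∈ E g (v * u) := by
    intro g u v hv x hx
    refine ⟨(hB _ _).2 ?_, mul_mul_inv_mem_of_mem_normalizer (hUV hv) hx.2⟩
    simpa [mul_assoc] using (hB _ _).1 hx.1
  have hEmul : ∀ g ∈ C, ∀ u, ∀ v ∈ V, E g (u * v) = E g u := by
    intro g hg u v hv
    ext x
    change x ∈ B (u * v * g) ∧ x ∈ V ↔ x ∈ B (u * g) ∧ x ∈ V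
    refine and_congr_left fun _ => ?_
    rw [hB, hB]
    have h := Subgroup.mem_normalizer_iff.1 (hVB g hg (V.inv_mem hv)) (u⁻¹ * x * u)
    rw [hB, hB] at h
    simpa [mul_assoc] using h.symm
  have hEV : ∀ g ∈ C, ∀ u ∈ U, V ≤ Subgroup.normalizer (E g u : Set G) := by
    intro g hg u hu
    refine le_normalizer_of_conj_mem fun v hv x hx => ?_
    have h := hEconj g u v (hVU hv) x hx
    have e : v * u = u * (u⁻¹ * v * u) := by group
    rwa [e, hEmul g hg u _ (inv_mul_mul_mem_of_mem_normalizer (hUV hu) hv)] at h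
  let 𝓑 : Set (Subgroup G) := Set.image2 E C U
  have hfin : 𝓑.Finite := by
    obtain ⟨R, -, hR⟩ := hUc.elim_nhds_subcover (fun u => {x | u⁻¹ * x ∈ V}) fun u _ => by
      have hcont : Continuous fun x : G => u⁻¹ * x := by fun_prop
      exact (hVo.preimage hcont).mem_nhds (by simp [V.one_mem])
    refine (Set.Finite.image2 E C.finite_toSet R.finite_toSet).subset ?_
    rintro _ ⟨g, hg, u, hu, rfl⟩
    obtain ⟨r, hr, hru⟩ := Set.mem_iUnion₂.1 (hR hu)
    refine ⟨g, hg, r, hr, ?_⟩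
    rw [← hEmul g hg r _ hru, mul_inv_cancel_left]
  have h1C : (1 : G) ∈ C := Finset.mem_insert_self _ _
  have hE1 : E 1 1 ∈ 𝓑 := ⟨1, h1C, 1, U.one_mem, rfl⟩
  have hE1ne : E 1 1 ≠ ⊥ := fun h => hne <| by
    refine hG.eq_bot_of_inf_eq_bot hAo hVo (eq_bot_iff.2 ?_)
    rw [← h]
    exact fun x hx => ⟨(hB _ _).2 (by simpa using hx.1), hx.2⟩
  -- `Z` will centralise `N`, so the germ quasi-centraliser of `N` is nontrivial.
  obtain ⟨Z, -, hZ, hZcomm⟩ := exists_le_forall_commute hE1ne (hEV 1 h1C 1 U.one_mem)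
    inf_le_right hfin (by
      rintro _ ⟨g, hg, u, hu, rfl⟩
      refine ⟨inf_le_right, hEV g hg u hu, fun x hx y hy => ?_⟩
      have h := hcomm _ ((hB _ _).1 hx.1) _ ((hB _ _).1 hy.1)
      generalize u * g = w at h
      calc x * y = w * ((w⁻¹ * x * w) * (w⁻¹ * y * w)) * w⁻¹ := by group
        _ = w * ((w⁻¹ * y * w) * (w⁻¹ * x * w)) * w⁻¹ := by rw [h]
        _ = y * x := by group)
  let N : Subgroup G := (sSup 𝓑).topologicalClosure
  have hEN : ∀ g ∈ C, ∀ u ∈ U, E g u ≤ N := fun g hg u hu =>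
    (le_sSup (show E g u ∈ 𝓑 from ⟨g, hg, u, hu, rfl⟩)).trans (Subgroup.le_topologicalClosure _)
  have hN : ∀ M : Subgroup G, IsClosed (M : Set G) → (∀ g ∈ C, ∀ u ∈ U, E g u ≤ M) → N ≤ M := by
    intro M hM h
    refine Subgroup.topologicalClosure_minimal _ (sSup_le ?_) hM
    rintro _ ⟨g, hg, u, hu, rfl⟩
    exact h g hg u hu
  have hNc : IsCompact (N : Set G) :=
    hVc.of_isClosed_subset (Subgroup.isClosed_topologicalClosure _)
      (hN V (V.isClosed_of_isOpen hVo) fun _ _ _ _ => inf_le_right)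
  have hUN : U ≤ Subgroup.normalizer (N : Set G) := by
    refine le_normalizer_of_conj_mem fun v hv x hx => ?_
    have hcont : Continuous fun x : G => v * x * v⁻¹ := by fun_prop
    exact hN (N.comap (MulAut.conj v).toMonoidHom)
      ((Subgroup.isClosed_topologicalClosure _).preimage hcont)
      (fun g hg u hu y hy => hEN g hg _ (U.mul_mem hv hu) (hEconj g u v hv y hy)) hx
  -- For `x` near `1` the commutator of `b` and `x` lies in `B g ⊓ V = E g 1 ≤ N`. Since `U` and
  -- such elements `b` generate `G`, the germ of `N` is invariant.
  have hloc : ∀ g ∈ C, ∀ b ∈ B g, ∀ᶠ x in 𝓝 (1 : G), x ∈ N → b * x * b⁻¹ ∈ N := by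
    intro g hg b hb
    have hcont : Continuous fun x : G => b * x * b⁻¹ * x⁻¹ := by fun_prop
    have ht := hcont.tendsto 1
    simp only [mul_one, mul_inv_cancel, inv_one] at ht
    filter_upwards [eventually_mem_of_isOpen hVo, ht.eventually (eventually_mem_of_isOpen hVo)]
      with x hx hx' hxN
    have h : b * x * b⁻¹ * x⁻¹ ∈ E g 1 := by
      refine ⟨?_, hx'⟩
      rw [one_mul]
      simpa [mul_assoc] using (B g).mul_mem hb
        (mul_mul_inv_mem_of_mem_normalizer (hVB g hg hx) ((B g).inv_mem hb))
    simpa using N.mul_mem (hEN g hg 1 U.one_mem h) hxN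
  have hloctop : localNormalizer N = ⊤ := by
    rw [eq_top_iff, ← hgen, Subgroup.closure_le]
    rintro f (hf | hf)
    · exact normalizer_le_localNormalizer N (hUN hf)
    · have hfC : c f ∈ C := Finset.mem_insert_of_mem (Finset.mem_image_of_mem c hf)
      have hfB : f ∈ B (c f) := (hB _ _).2 (hcA f hf)
      refine mem_localNormalizer_of_eventually (hloc _ hfC f hfB) ?_
      simpa using hloc _ hfC f⁻¹ ((B (c f)).inv_mem hfB)
  obtain ⟨⟨z, hz⟩, hz1⟩ := Subgroup.ne_bot_iff_exists_ne_one.1 hZ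
  have hzN : N ≤ Subgroup.centralizer {z} :=
    hN _ (Set.isClosed_centralizer _) fun g hg u hu x hx =>
      Subgroup.mem_centralizer_singleton_iff.2 (hZcomm _ ⟨g, hg, u, hu, rfl⟩ z hz x hx).symm
  obtain ⟨W, hWo, hW⟩ := hG.exists_inf_eq_bot hNc hUc hUo hUN hloctop fun h => by
    refine hz1 (Subtype.ext (Subgroup.mem_bot.1 (h ▸ ?_)))
    exact Eventually.of_forall fun x hx =>
      (Subgroup.mem_centralizer_singleton_iff.1 (hzN hx)).symm
  refine hE1ne (le_bot_iff.1 ((hEN 1 h1C 1 U.one_mem).trans ?_))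
  rw [hG.eq_bot_of_inf_eq_bot (isOpen_normalizer_of_le hUo hUN) hWo hW]

/-- For small `W`, `x` lies in the centraliser of `K ⊓ W` in `K`. This meets `W` in the centre of `K
⊓ W`, an abelian locally normal subgroup, so it is discrete and therefore trivial. -/
theorem eq_one_of_mem_quasiCentralizer {K : Subgroup G} (hK : IsCompact (K : Set G))
    (hKo : IsOpen (Subgroup.normalizer (K : Set G) : Set G)) {x : G} (hx : x ∈ K)
    (hx' : x ∈ quasiCentralizer K) : x = 1 := by
  obtain ⟨U, hUc, hUo, hUK⟩ := hG.exists_subgroup (eventually_mem_of_isOpen hKo)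
  obtain ⟨V, -, hVo, hV⟩ := hG.exists_subgroup hx'
  obtain ⟨W, hWU, hWV, hWo, hUW⟩ := exists_isOpen_le_normalizer hUc hUo hVo
  have hUC := le_normalizer_centralizer (le_normalizer_inf hUK hUW)
  have hclosed : IsClosed (Subgroup.centralizer ((K ⊓ W : Subgroup G) : Set G) : Set G) :=
    Set.isClosed_centralizer _
  have hZ : K ⊓ W ⊓ Subgroup.centralizer ((K ⊓ W : Subgroup G) : Set G) = ⊥ := by
    refine hG.eq_bot_of_commute ?_ (isOpen_normalizer_of_le hUo
      (le_normalizer_inf (le_normalizer_inf hUK hUW) hUC)) fun a ha b hb =>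
        (Subgroup.mem_centralizer_iff.1 hb.2 a ha.1)
    simpa using (hK.inter_right (W.isClosed_of_isOpen hWo)).inter_right hclosed
  have hC : K ⊓ Subgroup.centralizer ((K ⊓ W : Subgroup G) : Set G) = ⊥ := by
    refine hG.eq_bot_of_inf_eq_bot (isOpen_normalizer_of_le hUo (le_normalizer_inf hUK hUC)) hWo ?_
    rw [inf_right_comm, hZ]
  rw [← Subgroup.mem_bot, ← hC]
  exact ⟨hx, Subgroup.mem_centralizer_iff.2 fun y hy => (hV y (hWV hy.2) hy.1).symm⟩

/-- For a locally normal subgroup `K`, an element of the normaliser that centralises `K` near `1`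
centralises `K`. -/
theorem mem_centralizer_of_mem_quasiCentralizer {K : Subgroup G} (hK : IsCompact (K : Set G))
    (hKo : IsOpen (Subgroup.normalizer (K : Set G) : Set G)) {g : G}
    (hg : g ∈ Subgroup.normalizer (K : Set G)) (hg' : g ∈ quasiCentralizer K) :
    g ∈ Subgroup.centralizer (K : Set G) := by
  refine Subgroup.mem_centralizer_iff.2 fun k hk => ?_
  -- The commutator is in `K` because `g` normalises `K`, and in the germ quasi-centraliser because
  -- `k` normalises that.
  have h : g * k * g⁻¹ * k⁻¹ = 1 := by
    refine hG.eq_one_of_mem_quasiCentralizer hK hKo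
      (K.mul_mem (mul_mul_inv_mem_of_mem_normalizer hg hk) (K.inv_mem hk)) ?_
    have := (quasiCentralizer K).mul_mem hg' (conj_mem_quasiCentralizer
      ((quasiCentralizer K).inv_mem hg') (normalizer_le_localNormalizer K
        (Subgroup.le_normalizer hk)))
    simpa [mul_assoc] using this
  rw [mul_inv_eq_one, mul_inv_eq_iff_eq_mul] at h
  exact h.symm

/-! ### Pseudocomplements in the structure lattice -/

/-- The order of the structure lattice compares representatives near `1`. -/
theorem mk_le_mk_iff {K L : LocallyNormal G} :
    LN.mk K ≤ LN.mk L ↔ ∀ᶠ x in 𝓝 (1 : G), x ∈ K.toSubgroup → x ∈ L.toSubgroup := by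
  rw [LN.mk_le_mk]
  refine ⟨eventually_mem_of_relIndex_ne_zero L.isCompact.isClosed, fun h => ?_⟩
  obtain ⟨V, -, hVo, hV⟩ := hG.exists_subgroup h
  refine Subgroup.relIndex_ne_zero_trans (K := V ⊓ K.toSubgroup) ?_ ?_
  · rw [Subgroup.relIndex_eq_one.2 fun x (hx : x ∈ V ⊓ K.toSubgroup) => hV x hx.1 hx.2]
    exact one_ne_zero
  · rw [Subgroup.inf_relIndex_right]
    exact relIndex_ne_zero_of_isOpen K.isCompact hVo

/-- Disjoint classes only say that the intersection is discrete; it is trivial since discrete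
locally normal subgroups are. -/
theorem mk_inf_mk_eq_bot_iff {K L : LocallyNormal G} :
    LN.mk K ⊓ LN.mk L = ⊥ ↔ K.toSubgroup ⊓ L.toSubgroup = ⊥ := by
  have e : LN.mk K ⊓ LN.mk L = ⊥ ↔ LN.mk (K.inter L) ≤ LN.mk LocallyNormal.trivial :=
    le_bot_iff.symm
  rw [e, hG.mk_le_mk_iff]
  constructor
  · intro h
    obtain ⟨W, -, hWo, hW⟩ := hG.exists_subgroup h
    exact hG.eq_bot_of_inf_eq_bot (K.inter L).isOpen_normalizer hWo
      (eq_bot_iff.2 fun x hx => hW x hx.2 hx.1)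
  · intro h
    exact Eventually.of_forall fun x hx => h.le hx

/-- `C_U(K)` is a pseudocomplement of the class of `K`. -/
theorem inf_eq_bot_iff_le_of_isPerp {α β : LN G} (h : IsPerp α β) (γ : LN G) :
    γ ⊓ α = ⊥ ↔ γ ≤ β := by
  obtain ⟨U, hc, ho, K, -, hn, rfl, rfl⟩ := h
  induction γ using LN.ind with | h M => ?_
  rw [hG.mk_inf_mk_eq_bot_iff, hG.mk_le_mk_iff]
  constructor
  · intro h
    filter_upwards [eventually_mem_of_isOpen ho] with x hx hxM
    refine ⟨hx, hG.mem_centralizer_of_mem_quasiCentralizer K.isCompact K.isOpen_normalizer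
      (hn hx) ?_⟩
    filter_upwards [eventually_mem_of_isOpen M.isOpen_normalizer] with k hk hkK
    exact commute_of_inf_eq_bot h hxM hkK (hn hx) hk
  · intro h
    obtain ⟨W, -, hWo, hW⟩ := hG.exists_subgroup h
    refine hG.eq_bot_of_inf_eq_bot (M.inter K).isOpen_normalizer hWo (eq_bot_iff.2 ?_)
    intro x hx
    have hxC := (hW x hx.2 hx.1.1).2
    exact Subgroup.mem_bot.2 <| hG.eq_one_of_mem_quasiCentralizer K.isCompact
      K.isOpen_normalizer hx.1.2 (Eventually.of_forall fun y hy =>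
        (Subgroup.mem_centralizer_iff.1 hxC y hy).symm)

theorem exists_isPerp (α : LN G) : ∃ β, IsPerp α β := by
  induction α using LN.ind with | h K => ?_
  obtain ⟨U, hc, ho, hU⟩ := hG.exists_subgroup (eventually_mem_of_isOpen K.isOpen_normalizer)
  -- `K` need not lie in `U`, so it is replaced by the commensurable `K ∩ U`.
  refine ⟨_, U, hc, ho, K.inter (LocallyNormal.ofOpen U hc ho), inf_le_right,
    le_normalizer_inf hU Subgroup.le_normalizer, ?_, rfl⟩
  refine le_antisymm ?_ ?_
  · exact hG.mk_le_mk_iff.2 (Eventually.of_forall fun x hx => hx.1)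
  · exact hG.mk_le_mk_iff.2 ((eventually_mem_of_isOpen ho).mono fun x hx hxK => ⟨hxK, hx⟩)

theorem isPerp_perp (α : LN G) : IsPerp α (perp α) := by
  rw [perp, dif_pos (hG.exists_isPerp α)]
  exact (hG.exists_isPerp α).choose_spec

theorem inf_eq_bot_iff_le_perp (γ α : LN G) : γ ⊓ α = ⊥ ↔ γ ≤ perp α :=
  hG.inf_eq_bot_iff_le_of_isPerp (hG.isPerp_perp α) γ

/-- Every admissible choice of `U` and `K` yields a pseudocomplement, and pseudocomplements are
unique. -/
theorem isPerp_iff (α β : LN G) : IsPerp α β ↔ β = perp α := by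
  refine ⟨fun h => eq_of_forall_le_iff fun γ => ?_, fun h => h ▸ hG.isPerp_perp α⟩
  rw [← hG.inf_eq_bot_iff_le_of_isPerp h, hG.inf_eq_bot_iff_le_perp]

theorem smul_perp (g : G) (α : LN G) : g • perp α = perp (g • α) :=
  eq_of_forall_le_iff fun γ => by
    rw [LN.le_smul_iff, ← hG.inf_eq_bot_iff_le_perp, ← hG.inf_eq_bot_iff_le_perp]
    constructor <;> intro h
    · simpa [LN.smul_inf, LN.smul_bot] using congrArg (g • ·) h
    · simpa [LN.smul_inf, LN.smul_bot] using congrArg (g⁻¹ • ·) h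

theorem smul_perpJoin (g : G) (α β : LN G) :
    g • perpJoin α β = perpJoin (g • α) (g • β) := by
  rw [perpJoin, perpJoin, hG.smul_perp, LN.smul_inf, hG.smul_perp, hG.smul_perp]

theorem smul_mem_LC (g : G) {α : LN G} (h : α ∈ LC G) : g • α ∈ LC G := by
  obtain ⟨β, rfl⟩ := h
  exact ⟨g • β, (hG.smul_perp g β).symm⟩

/-- The conjugation action on the centraliser lattice. -/
noncomputable def permLC : G →* Equiv.Perm (LC G) :=
  letI : MulAction G (LC G) :=
    { smul := fun g a => ⟨g • a.1, hG.smul_mem_LC g a.2⟩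
      one_smul := fun a => Subtype.ext (one_smul G a.1)
      mul_smul := fun g h a => Subtype.ext (mul_smul g h a.1) }
  MulAction.toPermHom G (LC G)

theorem perp_bot {U : Subgroup G} (hc : IsCompact (U : Set G)) (ho : IsOpen (U : Set G)) :
    perp ⊥ = LN.mk (LocallyNormal.ofOpen U hc ho) := by
  refine le_antisymm ?_ ((hG.inf_eq_bot_iff_le_perp _ _).1 (inf_bot_eq _))
  induction perp (⊥ : LN G) using LN.ind with | h K => ?_
  exact hG.mk_le_mk_iff.2 ((eventually_mem_of_isOpen ho).mono fun x hx _ => hx)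

end MemS

end TDLC

theorem mainTheorem4 {G : Type*} [Group G] [TopologicalSpace G] [IsTopologicalGroup G]
    [T2Space G] (hG : TDLC.MemS G) :
    -- the operator `⊥` is well defined: `α^⊥` is the class of `C_U(K)` for every choice of `U`, `K`
    (∀ α β : TDLC.LN G, TDLC.IsPerp α β ↔ β = TDLC.perp α) ∧
    -- the centraliser lattice is a Boolean lattice for `∨'`, `∧` and `⊥`
    ∃ B : BooleanAlgebra (TDLC.LC G),
      (∀ a b : TDLC.LC G, ((B.sup a b : TDLC.LC G) : TDLC.LN G) = TDLC.perpJoin ↑a ↑b) ∧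
      (∀ a b : TDLC.LC G, ((B.inf a b : TDLC.LC G) : TDLC.LN G) = (a : TDLC.LN G) ⊓ ↑b) ∧
      (∀ a : TDLC.LC G, ((B.compl a : TDLC.LC G) : TDLC.LN G) = TDLC.perp ↑a) ∧
      (∀ a b : TDLC.LC G, B.le a b ↔ (a : TDLC.LN G) ≤ ↑b) ∧
      ((B.bot : TDLC.LC G) : TDLC.LN G) = ⊥ ∧
      (∀ (U : Subgroup G) (hc : IsCompact (U : Set G)) (ho : IsOpen (U : Set G)),
        ((B.top : TDLC.LC G) : TDLC.LN G) = TDLC.LN.mk (TDLC.LocallyNormal.ofOpen U hc ho)) ∧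
      -- the conjugation action of `G` restricts to an action by automorphisms
      ∃ φ : G →* Equiv.Perm (TDLC.LC G),
        (∀ (g : G) (a : TDLC.LC G), ((φ g a : TDLC.LC G) : TDLC.LN G) = g • (a : TDLC.LN G)) ∧
        (∀ (g : G) (a b : TDLC.LC G), B.le (φ g a) (φ g b) ↔ B.le a b) ∧
        (∀ (g : G) (a b : TDLC.LC G), φ g (B.sup a b) = B.sup (φ g a) (φ g b)) ∧
        (∀ (g : G) (a b : TDLC.LC G), φ g (B.inf a b) = B.inf (φ g a) (φ g b)) ∧
        (∀ (g : G) (a : TDLC.LC G), φ g (B.compl a) = B.compl (φ g a)) := by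

  refine ⟨hG.isPerp_iff, TDLC.booleanAlgebraOfPseudocomplement hG.inf_eq_bot_iff_le_perp,
    fun _ _ => rfl, fun _ _ => rfl, fun _ => rfl, fun _ _ => Iff.rfl, rfl,
    fun U hc ho => hG.perp_bot hc ho, hG.permLC, fun _ _ => rfl,
    fun g _ _ => TDLC.LN.smul_le_smul_iff g, fun g a b => Subtype.ext (hG.smul_perpJoin g a b),
    fun g a b => Subtype.ext (TDLC.LN.smul_inf g a b), fun g a => Subtype.ext (hG.smul_perp g a)⟩
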